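/- Let $p_0=(p_0(1),\dots,p_0(d))$ be a probability vector and $n\ge 1$ an integer. Consider the Poissonized multinomial model under the null: $n_0\sim\mathrm{Poisson}(n)$, independent of i.i.d. observations $Z^{(1)},Z^{(2)},\dots\in\{1,\dots,d\}$ with distribution $p_0$, and counts $X_i=\#\{1\le m\le n_0: Z^{(m)}=i\}$, $i=1,\dots,d$. 1. (Classical asymptotics.) Fix $d$, any probability vector $p_0$ on $\{1,\dots,d\}$ and positive weights $w_1,\dots,w_d$ that do not depend on $n$, and let $$T(w)=\sum_{i=1}^d\frac{(X_i-np_0(i))^2-X_i}{w_i}.$$ Then, as $n\to\infty$, $$\frac{T(w)}{n}\ \overset{d}{\to}\ \sum_{i=1}^d\frac{p_0(i)}{w_i}\,(Z_i-1),$$ where $Z_1,\dots,Z_d$ are independent $\chi^2_1$ random variables. 2. (High-dimensional asymptotics.) Let $p_0$ be uniform on $\{1,\dots,d\}$, and let $$T_{\ell_2}=\sum_{i=1}^d\left[(X_i-np_0(i))^2-X_i\right].$$ Its variance $\mathrm{Var}_0(T_{\ell_2})$ under the null is finite and positive. Along any sequence of pairs $(d,n)$ of positive integers with $d\to\infty$: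 * if $n/\sqrt d\to\infty$, then $T_{\ell_2}/\sqrt{\mathrm{Var}_0(T_{\ell_2})}\overset{d}{\to}N(0,1)$; * if $n/\sqrt d\to 0$, then $T_{\ell_2}/\sqrt{\mathrm{Var}_0(T_{\ell_2})}\overset{d}{\to}\delta_0$, the point mass at $0$. -/

import Mathlib

open MeasureTheory ProbabilityTheory Filter Topology
open scoped NNReal ENNReal

namespace PoissonizedMultinomial

/-- The law of `(n₀, (Z₁, Z₂, …))`, where the sample size `n₀` is `Poisson(n)`-distributed, the
observations `Z₁, Z₂, …` are i.i.d. with distribution `p` on `d` cells, and `n₀` is independent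
of the observations. The sample consists of the first `n₀` observations. -/
noncomputable def sampleLaw {d : ℕ} (n : ℕ) (p : PMF (Fin d)) : Measure (ℕ × (ℕ → Fin d)) :=
  (poissonMeasure (n : ℝ≥0)).prod (Measure.infinitePi fun _ : ℕ => p.toMeasure)

instance {d : ℕ} (n : ℕ) (p : PMF (Fin d)) : IsProbabilityMeasure (sampleLaw n p) := by
  unfold sampleLaw
  infer_instance

/-- The number `X_j` of observations in the sample that fall in cell `j`. -/
def count {d : ℕ} (j : Fin d) (s : ℕ × (ℕ → Fin d)) : ℕ :=
  ((Finset.range s.1).filter fun i => s.2 i = j).card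

/-- The weighted statistic `T(w) = ∑_j ((X_j - n p₀(j))² - X_j) / w_j`. -/
noncomputable def weightedStat {d : ℕ} (n : ℕ) (p₀ : PMF (Fin d)) (w : Fin d → ℝ)
    (s : ℕ × (ℕ → Fin d)) : ℝ :=
  ∑ j, (((count j s : ℝ) - n * (p₀ j).toReal) ^ 2 - count j s) / w j

/-- The statistic `T_{ℓ₂} = ∑_j [(X_j - n p₀(j))² - X_j]`. -/
noncomputable def ellTwoStat {d : ℕ} (n : ℕ) (p₀ : PMF (Fin d)) (s : ℕ × (ℕ → Fin d)) : ℝ :=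
  ∑ j, (((count j s : ℝ) - n * (p₀ j).toReal) ^ 2 - count j s)

/-- `T_{ℓ₂} / √(Var₀ T_{ℓ₂})`, the variance being taken under the null `p₀`. -/
noncomputable def standardizedEllTwo {d : ℕ} (n : ℕ) (p₀ : PMF (Fin d))
    (s : ℕ × (ℕ → Fin d)) : ℝ :=
  ellTwoStat n p₀ s / √(variance (ellTwoStat n p₀) (sampleLaw n p₀))

/-- The `χ²` distribution with one degree of freedom: the law of the square of a standard
normal variable. -/
noncomputable def chiSqOne : Measure ℝ := (gaussianReal 0 1).map fun x => x ^ 2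

instance : IsProbabilityMeasure chiSqOne :=
  Measure.isProbabilityMeasure_map (by fun_prop)

end PoissonizedMultinomial

/-!
Marking the observations of a Poisson sample by their cell turns the vector of counts into a
compound Poisson vector with steps in the standard basis; its characteristic function factorizes,
so the counts `X_j` are independent `Poisson(n p₀(j))` variables. Both statistics are therefore
weighted sums of independent terms `(X_j - r)² - X_j` with `r = n p₀(j)`, the second Charlier
polynomial of `Poisson(r)`, which has mean `0`, variance `2 r²` and fourth moment
`60 r⁴ + 144 r³ + 8 r²`.

For a fixed null, `X_j` is a sum of `n` i.i.d. `Poisson(p₀(j))` variables, and the central limit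
theorem and Slutsky's lemma give the limit of each term divided by `n`; independence passes to the
limit.

In high dimension, `Var₀(T) = 2 n² ∑ p₀(j)²`. Dividing the sum of the fourth moments by the square
of the variance leaves at most `33 (∑ p₀(j)⁴ / (∑ p₀(j)²)² + 1 / (n² ∑ p₀(j)²))`, which for the
uniform null is `33 (1 / d + d / n²)`, and Lyapunov's theorem yields the Gaussian limit when
`n / √d → ∞`. On the other hand `𝔼 |(X_j - r)² - X_j| ≤ 4 r²`, so `T / √Var₀(T)` is `O(n / √d)` in
`L¹` and collapses to `0` when `n / √d → 0`.
-/

namespace PoissonizedMultinomial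

section ConvergenceInDistribution

variable {ι Ω' : Type*} {_ : MeasurableSpace Ω'} {P' : Measure Ω'} [IsProbabilityMeasure P']

lemma tendstoInDistribution_of_map_eventuallyEq {E Ω'' : Type*} {_ : MeasurableSpace Ω''}
    {P'' : Measure Ω''} [IsProbabilityMeasure P''] {l : Filter ι} {Ω₁ Ω₂ : ι → Type*}
    {_ : ∀ i, MeasurableSpace (Ω₁ i)} {_ : ∀ i, MeasurableSpace (Ω₂ i)}
    {P₁ : ∀ i, Measure (Ω₁ i)} {P₂ : ∀ i, Measure (Ω₂ i)} [∀ i, IsProbabilityMeasure (P₁ i)]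
    [∀ i, IsProbabilityMeasure (P₂ i)] [TopologicalSpace E] [MeasurableSpace E]
    [OpensMeasurableSpace E] {X : ∀ i, Ω₁ i → E} {Y : ∀ i, Ω₂ i → E} {Z : Ω' → E} {T : Ω'' → E}
    (h : TendstoInDistribution X l Z P₁ P') (hY : ∀ i, AEMeasurable (Y i) (P₂ i))
    (hT : AEMeasurable T P'') (hXY : ∀ᶠ i in l, (P₁ i).map (X i) = (P₂ i).map (Y i))
    (hZT : P'.map Z = P''.map T) :
    TendstoInDistribution Y l T P₂ P'' where
  forall_aemeasurable := hY
  aemeasurable_limit := hT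
  tendsto := by
    have h_lim : (⟨P'.map Z, Measure.isProbabilityMeasure_map h.aemeasurable_limit⟩ :
        ProbabilityMeasure E) = ⟨P''.map T, Measure.isProbabilityMeasure_map hT⟩ :=
      Subtype.ext hZT
    exact h_lim ▸ h.tendsto.congr' (by filter_upwards [hXY] with i hi using Subtype.ext hi)

lemma tendstoInDistribution_iff_tendsto_charFun {E : Type*} [NormedAddCommGroup E]
    [InnerProductSpace ℝ E] [FiniteDimensional ℝ E] [MeasurableSpace E] [BorelSpace E]
    {Ω : ℕ → Type*} {_ : ∀ n, MeasurableSpace (Ω n)}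
    {P : ∀ n, Measure (Ω n)} [∀ n, IsProbabilityMeasure (P n)] {X : ∀ n, Ω n → E} {Z : Ω' → E}
    (hX : ∀ n, AEMeasurable (X n) (P n)) (hZ : AEMeasurable Z P') :
    TendstoInDistribution X atTop Z P P' ↔
      ∀ t, Tendsto (fun n => charFun ((P n).map (X n)) t) atTop (𝓝 (charFun (P'.map Z) t)) :=
  ⟨fun h t => ProbabilityMeasure.tendsto_iff_tendsto_charFun.1 h.tendsto t,
    fun h => ⟨hX, hZ, ProbabilityMeasure.tendsto_iff_tendsto_charFun.2 h⟩⟩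

lemma tendstoInDistribution_sum_of_iIndepFun {E : Type*} [NormedAddCommGroup E]
    [InnerProductSpace ℝ E] [FiniteDimensional ℝ E] [MeasurableSpace E] [BorelSpace E]
    [Fintype ι] {Ω : ℕ → Type*} {_ : ∀ n, MeasurableSpace (Ω n)} {P : ∀ n, Measure (Ω n)}
    [∀ n, IsProbabilityMeasure (P n)] {X : ∀ n, ι → Ω n → E} {Z : ι → Ω' → E}
    (h : ∀ i, TendstoInDistribution (fun n => X n i) atTop (Z i) P P')
    (hX : ∀ n, iIndepFun (X n) (P n)) (hZ : iIndepFun Z P') :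
    TendstoInDistribution (fun n ω => ∑ i, X n i ω) atTop (fun ω => ∑ i, Z i ω) P P' := by
  have hX_meas (n : ℕ) (i : ι) : AEMeasurable (X n i) (P n) := (h i).forall_aemeasurable n
  have hZ_meas (i : ι) : AEMeasurable (Z i) P' := (h i).aemeasurable_limit
  refine (tendstoInDistribution_iff_tendsto_charFun
    (fun n => Finset.aemeasurable_fun_sum _ fun i _ => hX_meas n i)
    (Finset.aemeasurable_fun_sum _ fun i _ => hZ_meas i)).2 fun t => ?_
  simp_rw [(hX _).charFun_map_fun_sum_eq_prod (hX_meas _), hZ.charFun_map_fun_sum_eq_prod hZ_meas,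
    Finset.prod_apply]
  exact tendsto_finsetProd _ fun i _ =>
    (tendstoInDistribution_iff_tendsto_charFun (fun n => hX_meas n i) (hZ_meas i)).1 (h i) t

lemma tendstoInDistribution_dirac_of_tendsto_integral_norm_sub {E : Type*} [NormedAddCommGroup E]
    [MeasurableSpace E] [BorelSpace E] {l : Filter ι} [l.IsCountablyGenerated]
    {Ω : ι → Type*} {_ : ∀ i, MeasurableSpace (Ω i)} {P : ∀ i, Measure (Ω i)}
    [∀ i, IsProbabilityMeasure (P i)] {X : ∀ i, Ω i → E} {c : E}
    (hX : ∀ i, Integrable (X i) (P i)) (h : Tendsto (fun i => ∫ ω, ‖X i ω - c‖ ∂P i) l (𝓝 0)) :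
    TendstoInDistribution X l id P (Measure.dirac c) where
  forall_aemeasurable i := (hX i).aemeasurable
  aemeasurable_limit := aemeasurable_id
  tendsto := by
    refine tendsto_iff_forall_lipschitz_integral_tendsto.2 fun F ⟨C, hC⟩ ⟨L, hF⟩ => ?_
    rw [tendsto_iff_norm_sub_tendsto_zero]
    refine squeeze_zero (fun _ => norm_nonneg _) (fun i => ?_) (by simpa using h.const_mul (L : ℝ))
    have h_int : Integrable (fun ω => F (X i ω)) (P i) :=
      .of_bound (hF.continuous.comp_aestronglyMeasurable (hX i).aestronglyMeasurable) (‖F c‖ + C)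
        (.of_forall fun ω => norm_le_of_mem_closedBall (hC _ _))
    simp only [ProbabilityMeasure.coe_mk, Measure.map_id, integral_dirac]
    rw [integral_map (hX i).aemeasurable hF.continuous.aestronglyMeasurable]
    calc ‖∫ ω, F (X i ω) ∂P i - F c‖ = ‖∫ ω, (F (X i ω) - F c) ∂P i‖ := by
          rw [integral_sub h_int (integrable_const _)]
          simp
      _ ≤ ∫ ω, L * ‖X i ω - c‖ ∂P i :=
          norm_integral_le_of_norm_le (((hX i).sub (integrable_const c)).norm.const_mul _)
            (.of_forall fun ω => hF.norm_sub_le _ _)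
      _ = L * ∫ ω, ‖X i ω - c‖ ∂P i := integral_const_mul _ _

end ConvergenceInDistribution
section Lyapunov

lemma norm_exp_mul_I_sub_le (x : ℝ) :
    ‖Complex.exp (x * Complex.I) - ((1 - x ^ 2 / 2 : ℝ) + x * Complex.I)‖ ≤ 4 * |x| ^ 3 := by
  have h_norm : ‖(x : ℂ) * Complex.I‖ = |x| := by simp
  rcases le_or_gt |x| 1 with h_le | h_gt
  · calc ‖Complex.exp (x * Complex.I) - ((1 - x ^ 2 / 2 : ℝ) + x * Complex.I)‖
        = ‖Complex.exp (x * Complex.I) -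
            ∑ m ∈ Finset.range 3, (x * Complex.I) ^ m / (m.factorial : ℂ)‖ := by
          congr 2
          simp only [Finset.sum_range_succ, Finset.range_zero, Finset.sum_empty, mul_pow,
            Complex.I_sq, Nat.factorial]
          push_cast
          ring
      _ ≤ |x| ^ 3 * ((Nat.succ 3 : ℝ) * ((Nat.factorial 3 : ℝ) * (3 : ℕ))⁻¹) := by
          simpa only [h_norm] using Complex.exp_bound (h_norm.trans_le h_le) three_pos
      _ ≤ 4 * |x| ^ 3 := by
          rw [mul_comm]
          gcongr
          norm_num [Nat.factorial]
  · calc ‖Complex.exp (x * Complex.I) - ((1 - x ^ 2 / 2 : ℝ) + x * Complex.I)‖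
        ≤ ‖Complex.exp (x * Complex.I)‖ +
            (‖((1 - x ^ 2 / 2 : ℝ) : ℂ)‖ + ‖(x : ℂ) * Complex.I‖) :=
          (norm_sub_le _ _).trans (by gcongr; exact norm_add_le _ _)
      _ = 1 + (|1 - x ^ 2 / 2| + |x|) := by
          rw [Complex.norm_exp_ofReal_mul_I, h_norm, Complex.norm_real, Real.norm_eq_abs]
      _ ≤ 1 + (1 + |x| ^ 2 / 2 + |x|) := by
          gcongr
          rw [sq_abs, abs_le]
          constructor <;> nlinarith [sq_nonneg x]
      _ ≤ 4 * |x| ^ 3 := by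
          nlinarith [mul_pos (sub_pos.2 h_gt) (sub_pos.2 h_gt), pow_pos (sub_pos.2 h_gt) 3]

lemma two_mul_abs_pow_three_le {a : ℝ} (ha : 0 < a) (x : ℝ) :
    2 * |x| ^ 3 ≤ a * x ^ 2 + a⁻¹ * x ^ 4 := by
  have h_sq : 0 ≤ a⁻¹ * |x| ^ 2 * (a - |x|) ^ 2 := by positivity
  have h_expand : a⁻¹ * |x| ^ 2 * (a - |x|) ^ 2 =
      a * |x| ^ 2 + a⁻¹ * (|x| ^ 2) ^ 2 - 2 * |x| ^ 3 := by
    field_simp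
    ring
  rw [h_expand, sq_abs] at h_sq
  linarith

lemma abs_exp_neg_sub_one_sub_le {y : ℝ} (hy : 0 ≤ y) :
    |Real.exp (-y) - (1 - y)| ≤ y ^ 2 / 2 := by
  have h_exp : Real.exp (-y) * (1 + y + y ^ 2 / 2) ≤ 1 := by
    calc Real.exp (-y) * (1 + y + y ^ 2 / 2) ≤ Real.exp (-y) * Real.exp y := by
          gcongr
          exact Real.quadratic_le_exp_of_nonneg hy
      _ = 1 := by rw [← Real.exp_add, neg_add_cancel, Real.exp_zero]
  rw [abs_of_nonneg (sub_nonneg.2 (Real.one_sub_le_exp_neg y))]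
  nlinarith [pow_nonneg hy 4, (by positivity : 0 < 1 + y + y ^ 2 / 2)]

lemma norm_prod_sub_prod_le {ι R : Type*} [NormedCommRing R] [NormOneClass R] {s : Finset ι}
    {z w : ι → R} (hz : ∀ i ∈ s, ‖z i‖ ≤ 1) (hw : ∀ i ∈ s, ‖w i‖ ≤ 1) :
    ‖∏ i ∈ s, z i - ∏ i ∈ s, w i‖ ≤ ∑ i ∈ s, ‖z i - w i‖ := by
  classical
  induction s using Finset.induction_on with
  | empty => simp
  | insert i s hi ih =>
    rw [Finset.forall_mem_insert] at hz hw
    have h_prod : ‖∏ j ∈ s, w j‖ ≤ 1 :=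
      (Finset.norm_prod_le _ _).trans (Finset.prod_le_one (fun _ _ => norm_nonneg _) hw.2)
    rw [Finset.prod_insert hi, Finset.prod_insert hi, Finset.sum_insert hi]
    calc ‖z i * ∏ j ∈ s, z j - w i * ∏ j ∈ s, w j‖
        = ‖(z i - w i) * ∏ j ∈ s, w j + z i * (∏ j ∈ s, z j - ∏ j ∈ s, w j)‖ := by
          congr 1
          ring
      _ ≤ ‖z i - w i‖ * 1 + 1 * ‖∏ j ∈ s, z j - ∏ j ∈ s, w j‖ := by
          refine (norm_add_le _ _).trans ?_
          gcongr
          · exact (norm_mul_le _ _).trans (by gcongr)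
          · exact (norm_mul_le _ _).trans (by gcongr; exact hz.1)
      _ ≤ ‖z i - w i‖ + ∑ j ∈ s, ‖z j - w j‖ := by
          rw [mul_one, one_mul]
          gcongr
          exact ih hz.2 hw.2

section Moments

variable {Ω : Type*} {_ : MeasurableSpace Ω} {P : Measure Ω}

lemma integrable_pow_of_memLp [IsFiniteMeasure P] {X : Ω → ℝ} {m k : ℕ} (hX : MemLp X m P)
    (hkm : k ≤ m) : Integrable (fun ω => X ω ^ k) P := by
  refine (integrable_norm_iff (hX.aestronglyMeasurable.pow k)).1 ?_
  simpa using (hX.mono_exponent (by exact_mod_cast hkm : (k : ℝ≥0∞) ≤ m)).integrable_norm_pow'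

variable [IsProbabilityMeasure P] {X : Ω → ℝ}

lemma sq_integral_sq_le (hX : MemLp X 4 P) :
    (∫ ω, X ω ^ 2 ∂P) ^ 2 ≤ ∫ ω, X ω ^ 4 ∂P := by
  have h_sq : MemLp (fun ω => X ω ^ 2) 2 P := by
    refine (memLp_two_iff_integrable_sq (hX.aestronglyMeasurable.pow 2)).2 ?_
    simpa only [Pi.pow_apply, ← pow_mul] using integrable_pow_of_memLp (m := 4) hX le_rfl
  have h_var := variance_eq_sub h_sq ▸ variance_nonneg (fun ω => X ω ^ 2) P
  simpa only [Pi.pow_apply, ← pow_mul, sub_nonneg] using h_var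

lemma integrable_exp_mul_I (hX : AEMeasurable X P) (t : ℝ) :
    Integrable (fun ω => Complex.exp ((t * X ω : ℝ) * Complex.I)) P := by
  refine .of_bound (C := 1) ?_ (.of_forall fun ω => (Complex.norm_exp_ofReal_mul_I _).le)
  exact ((by fun_prop : Measurable fun x : ℝ =>
    Complex.exp ((t * x : ℝ) * Complex.I)).comp_aemeasurable hX).aestronglyMeasurable

lemma integrable_and_integral_one_sub_sq_add_mul_I (hX : MemLp X 2 P)
    (h_mean : ∫ ω, X ω ∂P = 0) (t : ℝ) :
    Integrable (fun ω => ((1 - (t * X ω) ^ 2 / 2 : ℝ) : ℂ) + (t * X ω : ℝ) * Complex.I) P ∧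
      ∫ ω, (((1 - (t * X ω) ^ 2 / 2 : ℝ) : ℂ) + (t * X ω : ℝ) * Complex.I) ∂P =
        (1 - t ^ 2 / 2 * ∫ ω, X ω ^ 2 ∂P : ℝ) := by
  have h_sq : Integrable (fun ω => (t * X ω) ^ 2 / 2) P := by
    simpa only [mul_pow] using (hX.integrable_sq.const_mul (t ^ 2)).div_const 2
  have h_real : Integrable (fun ω => ((1 - (t * X ω) ^ 2 / 2 : ℝ) : ℂ)) P :=
    ((integrable_const 1).sub h_sq).ofReal
  have h_imag : Integrable (fun ω => ((t * X ω : ℝ) : ℂ) * Complex.I) P :=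
    ((hX.integrable one_le_two).const_mul t).ofReal.mul_const Complex.I
  refine ⟨h_real.add h_imag, ?_⟩
  rw [integral_add h_real h_imag, integral_mul_const, integral_complex_ofReal,
    integral_complex_ofReal, integral_const_mul, h_mean, integral_sub (integrable_const 1) h_sq]
  simp only [mul_pow, integral_div, integral_const_mul]
  simp [mul_div_right_comm]

lemma norm_charFun_map_sub_one_sub_le (hX : MemLp X 4 P) (h_mean : ∫ ω, X ω ∂P = 0)
    {a : ℝ} (ha : 0 < a) (t : ℝ) :
    ‖charFun (P.map X) t - (1 - t ^ 2 / 2 * ∫ ω, X ω ^ 2 ∂P : ℝ)‖ ≤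
      2 * |t| ^ 3 * (a * ∫ ω, X ω ^ 2 ∂P + a⁻¹ * ∫ ω, X ω ^ 4 ∂P) := by
  have hX_meas : AEMeasurable X P := hX.aestronglyMeasurable.aemeasurable
  have h_two : Integrable (fun ω => X ω ^ 2) P :=
    integrable_pow_of_memLp (m := 4) hX (by norm_num)
  have h_four : Integrable (fun ω => X ω ^ 4) P := integrable_pow_of_memLp (m := 4) hX le_rfl
  obtain ⟨h_int, h_taylor⟩ :=
    integrable_and_integral_one_sub_sq_add_mul_I (hX.mono_exponent (by norm_num)) h_mean t
  have h_charFun : charFun (P.map X) t = ∫ ω, Complex.exp ((t * X ω : ℝ) * Complex.I) ∂P := by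
    rw [charFun_apply_real, integral_map hX_meas (by fun_prop)]
    simp only [Complex.ofReal_mul]
  rw [h_charFun, ← h_taylor, ← integral_sub (integrable_exp_mul_I hX_meas t) h_int,
    ← integral_const_mul a, ← integral_const_mul a⁻¹,
    ← integral_add (h_two.const_mul a) (h_four.const_mul a⁻¹), ← integral_const_mul]
  refine norm_integral_le_of_norm_le
    (((h_two.const_mul a).add (h_four.const_mul a⁻¹)).const_mul _) (.of_forall fun ω => ?_)
  calc ‖Complex.exp ((t * X ω : ℝ) * Complex.I) -
        (((1 - (t * X ω) ^ 2 / 2 : ℝ) : ℂ) + (t * X ω : ℝ) * Complex.I)‖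
      ≤ 4 * |t * X ω| ^ 3 := norm_exp_mul_I_sub_le _
    _ = 2 * |t| ^ 3 * (2 * |X ω| ^ 3) := by
        rw [abs_mul]
        ring
    _ ≤ 2 * |t| ^ 3 * (a * X ω ^ 2 + a⁻¹ * X ω ^ 4) := by
        gcongr
        exact two_mul_abs_pow_three_le ha _

lemma norm_charFun_map_sub_exp_le (hX : MemLp X 4 P) (h_mean : ∫ ω, X ω ∂P = 0)
    {a : ℝ} (ha : 0 < a) (t : ℝ) :
    ‖charFun (P.map X) t - Real.exp (-(t ^ 2 / 2 * ∫ ω, X ω ^ 2 ∂P))‖ ≤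
      2 * |t| ^ 3 * (a * ∫ ω, X ω ^ 2 ∂P + a⁻¹ * ∫ ω, X ω ^ 4 ∂P) +
        t ^ 4 / 8 * ∫ ω, X ω ^ 4 ∂P := by
  have h_exp : ‖((1 - t ^ 2 / 2 * ∫ ω, X ω ^ 2 ∂P : ℝ) : ℂ) -
      Real.exp (-(t ^ 2 / 2 * ∫ ω, X ω ^ 2 ∂P))‖ ≤ t ^ 4 / 8 * ∫ ω, X ω ^ 4 ∂P := by
    rw [← Complex.ofReal_sub, Complex.norm_real, Real.norm_eq_abs, abs_sub_comm]
    calc |Real.exp (-(t ^ 2 / 2 * ∫ ω, X ω ^ 2 ∂P)) - (1 - t ^ 2 / 2 * ∫ ω, X ω ^ 2 ∂P)|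
        ≤ (t ^ 2 / 2 * ∫ ω, X ω ^ 2 ∂P) ^ 2 / 2 := abs_exp_neg_sub_one_sub_le (by positivity)
      _ = t ^ 4 / 8 * (∫ ω, X ω ^ 2 ∂P) ^ 2 := by ring
      _ ≤ t ^ 4 / 8 * ∫ ω, X ω ^ 4 ∂P := by
          gcongr
          exact sq_integral_sq_le hX
  exact (norm_sub_le_norm_sub_add_norm_sub _ _ _).trans
    (add_le_add (norm_charFun_map_sub_one_sub_le hX h_mean ha t) h_exp)

lemma norm_charFun_map_sum_sub_exp_le {ι : Type*} [Fintype ι] {X : ι → Ω → ℝ}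
    (hX : ∀ i, MemLp (X i) 4 P) (h_indep : iIndepFun X P) (h_mean : ∀ i, ∫ ω, X i ω ∂P = 0)
    {a : ℝ} (ha : 0 < a) (t : ℝ) :
    ‖charFun (P.map fun ω => ∑ i, X i ω) t -
        Real.exp (-(t ^ 2 / 2 * ∑ i, ∫ ω, X i ω ^ 2 ∂P))‖ ≤
      2 * |t| ^ 3 * (a * ∑ i, ∫ ω, X i ω ^ 2 ∂P + a⁻¹ * ∑ i, ∫ ω, X i ω ^ 4 ∂P) +
        t ^ 4 / 8 * ∑ i, ∫ ω, X i ω ^ 4 ∂P := by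
  have h_meas (i : ι) : AEMeasurable (X i) P := (hX i).aestronglyMeasurable.aemeasurable
  have (i : ι) : IsProbabilityMeasure (P.map (X i)) := Measure.isProbabilityMeasure_map (h_meas i)
  have h_exp_le (i : ι) : ‖(Real.exp (-(t ^ 2 / 2 * ∫ ω, X i ω ^ 2 ∂P)) : ℂ)‖ ≤ 1 := by
    rw [Complex.norm_real, Real.norm_eq_abs, Real.abs_exp, Real.exp_le_one_iff]
    exact neg_nonpos.2 (by positivity)
  have h_exp_sum : (Real.exp (-(t ^ 2 / 2 * ∑ i, ∫ ω, X i ω ^ 2 ∂P)) : ℂ) =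
      ∏ i, (Real.exp (-(t ^ 2 / 2 * ∫ ω, X i ω ^ 2 ∂P)) : ℂ) := by
    rw [Finset.mul_sum, ← Finset.sum_neg_distrib, Real.exp_sum, Complex.ofReal_prod]
  rw [h_indep.charFun_map_fun_sum_eq_prod h_meas, Finset.prod_apply, h_exp_sum]
  refine (norm_prod_sub_prod_le (fun i _ => norm_charFun_le_one _) fun i _ => h_exp_le i).trans ?_
  refine (Finset.sum_le_sum fun i _ => norm_charFun_map_sub_exp_le (hX i) (h_mean i) ha t).trans_eq
    ?_
  simp only [Finset.mul_sum, ← Finset.sum_add_distrib, mul_add]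

end Moments

section TriangularArray

variable {ι Ω : ℕ → Type*} [∀ k, Fintype (ι k)] {_ : ∀ k, MeasurableSpace (Ω k)}
  {P : ∀ k, Measure (Ω k)} [∀ k, IsProbabilityMeasure (P k)] {X : ∀ k, ι k → Ω k → ℝ} {v : ℝ≥0}

lemma tendsto_charFun_map_sum_sub_exp (hX : ∀ k i, MemLp (X k i) 4 (P k))
    (h_indep : ∀ k, iIndepFun (X k) (P k)) (h_mean : ∀ k i, ∫ ω, X k i ω ∂P k = 0)
    (h_var : Tendsto (fun k => ∑ i, ∫ ω, X k i ω ^ 2 ∂P k) atTop (𝓝 v))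
    (h_four : Tendsto (fun k => ∑ i, ∫ ω, X k i ω ^ 4 ∂P k) atTop (𝓝 0)) (t : ℝ) :
    Tendsto (fun k => charFun ((P k).map fun ω => ∑ i, X k i ω) t -
      Real.exp (-(t ^ 2 / 2 * ∑ i, ∫ ω, X k i ω ^ 2 ∂P k))) atTop (𝓝 0) := by
  let V := fun k => ∑ i, ∫ ω, X k i ω ^ 2 ∂P k
  let L := fun k => ∑ i, ∫ ω, X k i ω ^ 4 ∂P k
  -- The extra `1 / (k + 1)` keeps `a k` positive when `L k = 0`.
  let a : ℕ → ℝ := fun k => √(L k) + 1 / (k + 1)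
  have ha_pos (k : ℕ) : 0 < a k := by positivity
  have ha : Tendsto a atTop (𝓝 0) := by
    simpa only [Real.sqrt_zero, add_zero] using
      h_four.sqrt.add tendsto_one_div_add_atTop_nhds_zero_nat
  have hL (k : ℕ) : (a k)⁻¹ * L k ≤ √(L k) := by
    have hL_nonneg : 0 ≤ L k := Finset.sum_nonneg fun i _ =>
      integral_nonneg fun ω => Even.pow_nonneg (by decide) _
    rw [inv_mul_le_iff₀ (ha_pos k)]
    calc L k = √(L k) * √(L k) := (Real.mul_self_sqrt hL_nonneg).symm
      _ ≤ a k * √(L k) := by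
          gcongr
          exact le_add_of_nonneg_right (by positivity)
  have h_bound : Tendsto (fun k => 2 * |t| ^ 3 * (a k * V k + √(L k)) + t ^ 4 / 8 * L k)
      atTop (𝓝 0) := by
    simpa using (((ha.mul h_var).add h_four.sqrt).const_mul (2 * |t| ^ 3)).add
      (h_four.const_mul (t ^ 4 / 8))
  refine squeeze_zero_norm (fun k => ?_) h_bound
  refine (norm_charFun_map_sum_sub_exp_le (hX k) (h_indep k) (h_mean k) (ha_pos k) t).trans ?_
  gcongr
  exact hL k

theorem tendstoInDistribution_sum_of_tendsto_sum_integral_pow_four {Ω' : Type*}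
    {_ : MeasurableSpace Ω'} {P' : Measure Ω'} [IsProbabilityMeasure P'] {Z : Ω' → ℝ}
    (hX : ∀ k i, MemLp (X k i) 4 (P k)) (h_indep : ∀ k, iIndepFun (X k) (P k))
    (h_mean : ∀ k i, ∫ ω, X k i ω ∂P k = 0)
    (h_var : Tendsto (fun k => ∑ i, ∫ ω, X k i ω ^ 2 ∂P k) atTop (𝓝 v))
    (h_four : Tendsto (fun k => ∑ i, ∫ ω, X k i ω ^ 4 ∂P k) atTop (𝓝 0))
    (hZ : HasLaw Z (gaussianReal 0 v) P') :
    TendstoInDistribution (fun k ω => ∑ i, X k i ω) atTop Z P P' := by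
  refine (tendstoInDistribution_iff_tendsto_charFun (fun k => Finset.aemeasurable_fun_sum _
    fun i _ => (hX k i).aestronglyMeasurable.aemeasurable) hZ.aemeasurable).2 fun t => ?_
  have h_lim : charFun (P'.map Z) t = (Real.exp (-(t ^ 2 / 2 * v)) : ℂ) := by
    rw [hZ.map_eq, charFun_gaussianReal]
    push_cast
    ring_nf
  have h_exp : Tendsto (fun k => (Real.exp (-(t ^ 2 / 2 * ∑ i, ∫ ω, X k i ω ^ 2 ∂P k)) : ℂ))
      atTop (𝓝 (charFun (P'.map Z) t)) := by
    rw [h_lim]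
    exact (Complex.continuous_ofReal.tendsto _).comp
      ((Real.continuous_exp.tendsto _).comp (h_var.const_mul _).neg)
  simpa using (tendsto_charFun_map_sum_sub_exp hX h_indep h_mean h_var h_four t).add h_exp

end TriangularArray

end Lyapunov

lemma hasSum_poisson_descFactorial (r : ℝ≥0) (j : ℕ) :
    HasSum (fun k : ℕ => Real.exp (-r) * (r : ℝ) ^ k / (k.factorial : ℝ) * k.descFactorial j)
      ((r : ℝ) ^ j) := by
  have h_shift : HasSum
      (fun k : ℕ => (r : ℝ) ^ j * (Real.exp (-r) * (r : ℝ) ^ k / (k.factorial : ℝ)))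
      ((r : ℝ) ^ j) := by
    simpa using (hasSum_one_poissonMeasure r).mul_left ((r : ℝ) ^ j)
  refine ((add_left_injective j).hasSum_iff fun k hk => ?_).1 (h_shift.congr_fun fun k => ?_)
  · have hkj : k < j := by
      by_contra! hjk
      exact hk ⟨k - j, Nat.sub_add_cancel hjk⟩
    simp [Nat.descFactorial_of_lt hkj]
  · have h_factorial : ((k + j).factorial : ℝ) = k.factorial * (k + j).descFactorial j := by
      rw [← Nat.cast_mul, ← Nat.factorial_mul_descFactorial (Nat.le_add_left j k),
        Nat.add_sub_cancel]
    have h_desc : ((k + j).descFactorial j : ℝ) ≠ 0 := by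
      simp [Nat.descFactorial_eq_zero_iff_lt]
    simp only [Function.comp, h_factorial, pow_add]
    field_simp

lemma integrable_descFactorial_poissonMeasure (r : ℝ≥0) (j : ℕ) :
    Integrable (fun k : ℕ => (k.descFactorial j : ℝ)) (poissonMeasure r) := by
  rw [integrable_poissonMeasure_iff]
  simpa using (hasSum_poisson_descFactorial r j).summable

lemma integral_descFactorial_poissonMeasure (r : ℝ≥0) (j : ℕ) :
    ∫ k : ℕ, (k.descFactorial j : ℝ) ∂(poissonMeasure r) = (r : ℝ) ^ j := by
  rw [integral_poissonMeasure]
  simpa using (hasSum_poisson_descFactorial r j).tsum_eq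

lemma integrable_sum_mul_descFactorial_poissonMeasure (r : ℝ≥0) {m : ℕ} (c : Fin m → ℝ) :
    Integrable (fun k : ℕ => ∑ j, c j * (k.descFactorial j : ℝ)) (poissonMeasure r) :=
  integrable_finsetSum _ fun j _ => (integrable_descFactorial_poissonMeasure r j).const_mul (c j)

lemma integral_sum_mul_descFactorial_poissonMeasure (r : ℝ≥0) {m : ℕ} (c : Fin m → ℝ) :
    ∫ k : ℕ, ∑ j, c j * (k.descFactorial j : ℝ) ∂(poissonMeasure r) =
      ∑ j, c j * (r : ℝ) ^ (j : ℕ) := by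
  rw [integral_finsetSum _ fun (j : Fin m) _ =>
    (integrable_descFactorial_poissonMeasure r j).const_mul (c j)]
  simp_rw [integral_const_mul, integral_descFactorial_poissonMeasure]

lemma cast_descFactorial_eq_prod (k j : ℕ) :
    (k.descFactorial j : ℝ) = ∏ i ∈ Finset.range j, ((k : ℝ) - i) := by
  rw [← descPochhammer_eval_eq_descFactorial, descPochhammer_eval_eq_prod_range]

lemma natCast_sub_sq_eq_sum_descFactorial (r : ℝ) (k : ℕ) :
    ((k : ℝ) - r) ^ 2 =
      ∑ j, (![r ^ 2, -2 * r + 1, 1] : Fin 3 → ℝ) j * (k.descFactorial j : ℝ) := by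
  simp only [cast_descFactorial_eq_prod, Fin.sum_univ_three, Matrix.cons_val,
    Fin.coe_ofNat_eq_mod, Finset.prod_range_succ, Finset.prod_range_zero, Nat.zero_mod]
  push_cast
  ring

lemma integral_natCast_poissonMeasure (r : ℝ≥0) :
    ∫ k : ℕ, (k : ℝ) ∂(poissonMeasure r) = r := by
  simpa using integral_descFactorial_poissonMeasure r 1

lemma memLp_natCast_poissonMeasure (r : ℝ≥0) :
    MemLp (fun k : ℕ => (k : ℝ)) 2 (poissonMeasure r) := by
  refine (memLp_two_iff_integrable_sq .of_discrete).2 ?_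
  have h_sq := integrable_sum_mul_descFactorial_poissonMeasure r _ |>.congr <|
    .of_forall fun k => (natCast_sub_sq_eq_sum_descFactorial 0 k).symm
  simpa only [sub_zero] using h_sq

lemma variance_natCast_poissonMeasure (r : ℝ≥0) :
    variance (fun k : ℕ => (k : ℝ)) (poissonMeasure r) = r := by
  rw [variance_eq_integral .of_discrete, integral_natCast_poissonMeasure]
  simp_rw [natCast_sub_sq_eq_sum_descFactorial, integral_sum_mul_descFactorial_poissonMeasure]
  simp only [Fin.sum_univ_three, Matrix.cons_val, Fin.coe_ofNat_eq_mod]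
  ring

/-- The contribution `(k - r)² - k` to the statistic of a cell with count `k` and expected count
`r`. As a function of `k` it is the second Charlier polynomial of `Poisson(r)`. -/
def cellStat (r : ℝ) (k : ℕ) : ℝ := (k - r) ^ 2 - k

lemma cellStat_eq_sum_descFactorial (r : ℝ) (k : ℕ) :
    cellStat r k = ∑ j, (![r ^ 2, -2 * r, 1] : Fin 3 → ℝ) j * (k.descFactorial j : ℝ) := by
  simp only [cellStat, cast_descFactorial_eq_prod, Fin.sum_univ_three, Matrix.cons_val,
    Fin.coe_ofNat_eq_mod, Finset.prod_range_succ, Finset.prod_range_zero, Nat.zero_mod]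
  push_cast
  ring

lemma cellStat_sq_eq_sum_descFactorial (r : ℝ) (k : ℕ) :
    cellStat r k ^ 2 =
      ∑ j, (![r ^ 4, -4 * r ^ 3 + 4 * r ^ 2, 6 * r ^ 2 - 8 * r + 2, -4 * r + 4, 1] :
        Fin 5 → ℝ) j * (k.descFactorial j : ℝ) := by
  simp only [cellStat, cast_descFactorial_eq_prod, Fin.sum_univ_five, Matrix.cons_val,
    Fin.coe_ofNat_eq_mod, Finset.prod_range_succ, Finset.prod_range_zero, Nat.zero_mod]
  push_cast
  ring

lemma cellStat_pow_four_eq_sum_descFactorial (r : ℝ) (k : ℕ) :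
    cellStat r k ^ 4 =
      ∑ j, (![r ^ 8,
        -8 * r ^ 7 + 24 * r ^ 6 - 32 * r ^ 5 + 16 * r ^ 4,
        28 * r ^ 6 - 144 * r ^ 5 + 316 * r ^ 4 - 352 * r ^ 3 + 208 * r ^ 2 - 64 * r + 8,
        -56 * r ^ 5 + 360 * r ^ 4 - 944 * r ^ 3 + 1232 * r ^ 2 - 800 * r + 208,
        70 * r ^ 4 - 480 * r ^ 3 + 1256 * r ^ 2 - 1472 * r + 652,
        -56 * r ^ 3 + 360 * r ^ 2 - 784 * r + 576,
        28 * r ^ 2 - 144 * r + 188,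
        -8 * r + 24,
        1] : Fin 9 → ℝ) j * (k.descFactorial j : ℝ) := by
  simp only [cellStat, cast_descFactorial_eq_prod, Fin.sum_univ_castSucc, Fin.reduceCastSucc,
    Fin.reduceLast, Matrix.cons_val, Fin.coe_ofNat_eq_mod, Finset.prod_range_succ,
    Finset.prod_range_zero, Nat.zero_mod]
  push_cast
  ring

lemma memLp_four_cellStat (r : ℝ≥0) : MemLp (cellStat r) 4 (poissonMeasure r) := by
  have h_pow := integrable_sum_mul_descFactorial_poissonMeasure r _ |>.congr <|
    .of_forall fun k => (cellStat_pow_four_eq_sum_descFactorial r k).symm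
  refine (integrable_norm_rpow_iff .of_discrete (by norm_num) (by norm_num)).1 ?_
  refine h_pow.congr <| .of_forall fun k => ?_
  norm_num [Real.norm_eq_abs, Even.pow_abs]

lemma memLp_two_cellStat (r : ℝ≥0) : MemLp (cellStat r) 2 (poissonMeasure r) :=
  (memLp_four_cellStat r).mono_exponent (by norm_num)

lemma integral_cellStat (r : ℝ≥0) : ∫ k, cellStat r k ∂(poissonMeasure r) = 0 := by
  simp_rw [cellStat_eq_sum_descFactorial, integral_sum_mul_descFactorial_poissonMeasure]
  simp only [Fin.sum_univ_three, Matrix.cons_val, Fin.coe_ofNat_eq_mod]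
  ring

lemma integral_cellStat_sq (r : ℝ≥0) :
    ∫ k, cellStat r k ^ 2 ∂(poissonMeasure r) = 2 * (r : ℝ) ^ 2 := by
  simp_rw [cellStat_sq_eq_sum_descFactorial, integral_sum_mul_descFactorial_poissonMeasure]
  simp only [Fin.sum_univ_five, Matrix.cons_val, Fin.coe_ofNat_eq_mod]
  ring

lemma integral_cellStat_pow_four (r : ℝ≥0) :
    ∫ k, cellStat r k ^ 4 ∂(poissonMeasure r) =
      60 * (r : ℝ) ^ 4 + 144 * (r : ℝ) ^ 3 + 8 * (r : ℝ) ^ 2 := by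
  simp_rw [cellStat_pow_four_eq_sum_descFactorial, integral_sum_mul_descFactorial_poissonMeasure]
  simp only [Fin.sum_univ_castSucc, Fin.reduceCastSucc, Fin.reduceLast, Matrix.cons_val,
    Fin.coe_ofNat_eq_mod]
  ring

lemma integral_cellStat_pow_four_le (r : ℝ≥0) :
    ∫ k, cellStat r k ^ 4 ∂(poissonMeasure r) ≤ 132 * ((r : ℝ) ^ 4 + (r : ℝ) ^ 2) := by
  rw [integral_cellStat_pow_four]
  nlinarith [sq_nonneg (r * (r - 1) : ℝ), sq_nonneg (r : ℝ)]

lemma abs_cellStat_le {r : ℝ} (hr : 0 ≤ r) (k : ℕ) :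
    |cellStat r k| ≤ ∑ j, (![r ^ 2, 2 * r, 1] : Fin 3 → ℝ) j * (k.descFactorial j : ℝ) := by
  rw [cellStat_eq_sum_descFactorial]
  refine (Finset.abs_sum_le_sum_abs _ _).trans_eq ?_
  simp [Fin.sum_univ_succ, abs_mul, abs_of_nonneg hr]

lemma integral_abs_cellStat_le (r : ℝ≥0) :
    ∫ k, |cellStat r k| ∂(poissonMeasure r) ≤ 4 * (r : ℝ) ^ 2 := by
  calc ∫ k, |cellStat r k| ∂(poissonMeasure r)
      ≤ ∫ k : ℕ, ∑ j, (![(r : ℝ) ^ 2, 2 * r, 1] : Fin 3 → ℝ) j * (k.descFactorial j : ℝ)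
          ∂(poissonMeasure r) :=
        integral_mono ((memLp_two_cellStat r).integrable one_le_two).abs
          (integrable_sum_mul_descFactorial_poissonMeasure r _) (abs_cellStat_le r.2)
    _ = 4 * (r : ℝ) ^ 2 := by
        rw [integral_sum_mul_descFactorial_poissonMeasure]
        simp only [Fin.sum_univ_three, Matrix.cons_val, Fin.coe_ofNat_eq_mod]
        ring

lemma integral_pow_poissonMeasure (r : ℝ≥0) (z : ℂ) :
    ∫ m : ℕ, z ^ m ∂(poissonMeasure r) = Complex.exp (r * (z - 1)) := by
  rw [integral_poissonMeasure]
  calc ∑' m : ℕ, (Real.exp (-r) * (r : ℝ) ^ m / (m.factorial : ℝ)) • z ^ m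
      = ∑' m : ℕ, (Real.exp (-r) : ℂ) * ((r * z) ^ m / (m.factorial : ℂ)) := by
        congr with m
        rw [Complex.real_smul]
        push_cast
        ring
    _ = (Real.exp (-r) : ℂ) * Complex.exp (r * z) := by
        rw [tsum_mul_left, (NormedSpace.expSeries_div_hasSum_exp ((r : ℂ) * z)).tsum_eq,
          Complex.exp_eq_exp_ℂ]
    _ = Complex.exp (r * (z - 1)) := by
        rw [Complex.ofReal_exp, ← Complex.exp_add]
        push_cast
        ring_nf

section CompoundPoisson

variable {α E : Type*} [MeasurableSpace α] [NormedAddCommGroup E] [InnerProductSpace ℝ E]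
  [MeasurableSpace E] [BorelSpace E] [SecondCountableTopology E]
  (ν : Measure α) [IsProbabilityMeasure ν] {f : α → E}

lemma charFun_map_sum_range_infinitePi (hf : Measurable f) (m : ℕ) (t : E) :
    charFun ((Measure.infinitePi fun _ : ℕ => ν).map fun x => ∑ i ∈ Finset.range m, f (x i)) t =
      charFun (ν.map f) t ^ m := by
  have h_indep : iIndepFun (fun i (x : ℕ → α) => f (x i)) (Measure.infinitePi fun _ => ν) :=
    iIndepFun_infinitePi (X := fun _ => f) fun _ => hf
  have h_law (i : ℕ) : (Measure.infinitePi fun _ => ν).map (fun x => f (x i)) = ν.map f := by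
    conv_rhs => rw [← (measurePreserving_eval_infinitePi (fun _ : ℕ => ν) i).map_eq]
    rw [Measure.map_map hf (measurable_pi_apply i)]
    rfl
  have h_meas (i : ℕ) : Measurable fun x : ℕ → α => f (x i) := hf.comp (measurable_pi_apply i)
  rw [(h_indep.restrict (Finset.range m)).charFun_map_fun_finsetSum_eq_prod
    fun i _ => (h_meas i).aemeasurable]
  simp [h_law]

lemma charFun_map_sum_range_poissonMeasure (r : ℝ≥0) (hf : Measurable f) (t : E) :
    charFun (((poissonMeasure r).prod (Measure.infinitePi fun _ : ℕ => ν)).map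
        fun s => ∑ i ∈ Finset.range s.1, f (s.2 i)) t =
      Complex.exp (r * (charFun (ν.map f) t - 1)) := by
  have h_meas_sum (m : ℕ) : Measurable fun x : ℕ → α => ∑ i ∈ Finset.range m, f (x i) :=
    Finset.measurable_sum (Finset.range m) fun i _ => hf.comp (measurable_pi_apply i)
  have h_meas : Measurable fun s : ℕ × (ℕ → α) => ∑ i ∈ Finset.range s.1, f (s.2 i) :=
    measurable_from_prod_countable_right h_meas_sum
  have h_fiber (m : ℕ) : ∫ x : ℕ → α,
      Complex.exp (inner ℝ (∑ i ∈ Finset.range m, f (x i)) t * Complex.I)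
        ∂(Measure.infinitePi fun _ : ℕ => ν) = charFun (ν.map f) t ^ m := by
    rw [← charFun_map_sum_range_infinitePi ν hf, charFun_apply,
      integral_map (h_meas_sum m).aemeasurable (by fun_prop)]
  have h_int : Integrable (fun s : ℕ × (ℕ → α) =>
      Complex.exp (inner ℝ (∑ i ∈ Finset.range s.1, f (s.2 i)) t * Complex.I))
      ((poissonMeasure r).prod (Measure.infinitePi fun _ : ℕ => ν)) := by
    refine .of_bound (C := 1) ?_ (.of_forall fun s => (Complex.norm_exp_ofReal_mul_I _).le)
    exact (Measurable.comp (g := fun y : E => Complex.exp (inner ℝ y t * Complex.I))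
      (by fun_prop) h_meas).aestronglyMeasurable
  rw [charFun_apply, integral_map h_meas.aemeasurable (by fun_prop), integral_prod _ h_int]
  simp_rw [h_fiber, integral_pow_poissonMeasure]

end CompoundPoisson

lemma sum_toReal_eq_one {α : Type*} [Fintype α] (p : PMF α) : ∑ a, (p a).toReal = 1 := by
  rw [← ENNReal.toReal_sum fun a _ => p.apply_ne_top a, ← tsum_fintype (L := .unconditional _),
    p.tsum_coe, ENNReal.toReal_one]

/-- The expected number `n p(j)` of observations in cell `j`, as a Poisson rate. -/
noncomputable def cellRate {d : ℕ} (n : ℕ) (p : PMF (Fin d)) (j : Fin d) : ℝ≥0 :=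
  n * (p j).toNNReal

@[simp]
lemma coe_cellRate {d : ℕ} (n : ℕ) (p : PMF (Fin d)) (j : Fin d) :
    (cellRate n p j : ℝ) = n * (p j).toReal := rfl

section Counts

variable {d : ℕ} (n : ℕ) (p : PMF (Fin d))

lemma charFun_map_single (t : EuclideanSpace ℝ (Fin d)) :
    charFun (p.toMeasure.map fun j => EuclideanSpace.single j (1 : ℝ)) t =
      ∑ j, (p j).toReal * Complex.exp (t j * Complex.I) := by
  rw [charFun_apply, integral_map (by fun_prop) (by fun_prop), PMF.integral_eq_sum]
  simp [EuclideanSpace.inner_single_left]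

lemma toLp_count_eq_sum_single (s : ℕ × (ℕ → Fin d)) :
    WithLp.toLp 2 (fun j => (count j s : ℝ)) =
      ∑ i ∈ Finset.range s.1, EuclideanSpace.single (s.2 i) (1 : ℝ) := by
  ext j
  simp [count, Pi.single_apply, eq_comm (a := j)]

lemma measurable_count (j : Fin d) : Measurable (count j) := by
  refine measurable_from_prod_countable_right fun m => ?_
  simp only [count, Finset.card_filter]
  refine Finset.measurable_sum _ fun i _ => ?_
  exact (Measurable.of_discrete (f := fun a : Fin d => if a = j then 1 else 0)).comp
    (measurable_pi_apply i)

lemma measurable_natCast_count :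
    Measurable fun (s : ℕ × (ℕ → Fin d)) (j : Fin d) => (count j s : ℝ) :=
  measurable_pi_lambda _ fun j => measurable_from_top.comp (measurable_count j)

lemma map_natCast_count :
    (sampleLaw n p).map (fun s j => (count j s : ℝ)) =
      Measure.pi fun j => (poissonMeasure (cellRate n p j)).map (Nat.cast : ℕ → ℝ) := by
  have := Measure.isProbabilityMeasure_map (μ := sampleLaw n p)
    measurable_natCast_count.aemeasurable
  refine charFun_eq_pi_iff.1 fun t => ?_
  rw [Measure.map_map (by fun_prop) measurable_natCast_count]
  simp only [Function.comp_def, toLp_count_eq_sum_single]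
  rw [sampleLaw, charFun_map_sum_range_poissonMeasure
    (f := fun j => EuclideanSpace.single j (1 : ℝ)) _ _ .of_discrete, charFun_map_single]
  simp_rw [charFun_map_cast_poissonMeasure]
  rw [← Complex.exp_sum]
  have h_one : (1 : ℂ) = ∑ j, ((p j).toReal : ℂ) := by
    rw [← Complex.ofReal_sum, sum_toReal_eq_one, Complex.ofReal_one]
  conv_lhs => rw [h_one]
  rw [← Finset.sum_sub_distrib, Finset.mul_sum]
  congr! 2 with j
  rw [coe_cellRate]
  push_cast
  ring

lemma hasLaw_count_pi :
    HasLaw (fun s j => count j s) (Measure.pi fun j => poissonMeasure (cellRate n p j))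
      (sampleLaw n p) := by
  have h_meas : Measurable fun (s : ℕ × (ℕ → Fin d)) (j : Fin d) => count j s :=
    measurable_pi_lambda _ measurable_count
  refine ⟨h_meas.aemeasurable, ?_⟩
  -- The floor undoes the cast, which transfers the real-valued identity to `ℕ`.
  have h_floor := congrArg (Measure.map fun (x : Fin d → ℝ) j => ⌊x j⌋₊) (map_natCast_count n p)
  rw [Measure.map_map (by fun_prop) measurable_natCast_count,
    Measure.pi_map_pi fun _ => by fun_prop] at h_floor
  simp_rw [Measure.map_map (g := Nat.floor (α := ℝ)) Nat.measurable_floor measurable_from_top]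
    at h_floor
  simpa [Function.comp_def] using h_floor

lemma hasLaw_count (j : Fin d) :
    HasLaw (count j) (poissonMeasure (cellRate n p j)) (sampleLaw n p) :=
  (measurePreserving_eval _ j).fun_comp_hasLaw (hasLaw_count_pi n p)

lemma iIndepFun_count : iIndepFun (fun j : Fin d => count j) (sampleLaw n p) :=
  (iIndepFun_iff_hasLaw_pi_pi (hasLaw_count n p)).2 (hasLaw_count_pi n p)

end Counts

lemma poissonMeasure_zero : poissonMeasure 0 = Measure.dirac 0 := by
  refine Measure.ext_of_singleton fun k => ?_
  rw [poissonMeasure_singleton]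
  cases k <;> simp

lemma hasLaw_sum_poissonMeasure {ι Ω : Type*} {_ : MeasurableSpace Ω} {P : Measure Ω}
    {X : ι → Ω → ℕ} {r : ι → ℝ≥0} (hX : ∀ i, HasLaw (X i) (poissonMeasure (r i)) P)
    (h_indep : iIndepFun X P) (s : Finset ι) :
    HasLaw (∑ i ∈ s, X i) (poissonMeasure (∑ i ∈ s, r i)) P := by
  classical
  have := h_indep.isProbabilityMeasure
  induction s using Finset.induction_on with
  | empty =>
    rw [Finset.sum_empty, Finset.sum_empty, poissonMeasure_zero]
    exact hasLaw_dirac_of_ae_eq .rfl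
  | insert i s hi ih =>
    rw [Finset.sum_insert hi, Finset.sum_insert hi]
    have h_indep_sum : IndepFun (X i) (∑ j ∈ s, X j) P :=
      (h_indep.indepFun_finsetSum_of_notMem₀ (fun j => (hX j).aemeasurable) hi).symm
    exact h_indep_sum.hasLaw_add_poissonMeasure (hX i) ih

lemma hasLaw_sum_range_infinitePi_poissonMeasure (r : ℝ≥0) (n : ℕ) :
    HasLaw (fun x : ℕ → ℕ => ∑ k ∈ Finset.range n, x k) (poissonMeasure (n * r))
      (Measure.infinitePi fun _ => poissonMeasure r) := by
  have h_sum := hasLaw_sum_poissonMeasure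
    (fun k => (measurePreserving_eval_infinitePi (fun _ : ℕ => poissonMeasure r) k).hasLaw)
    (iIndepFun_infinitePi (X := fun _ => id) fun _ => measurable_id) (Finset.range n)
  simpa [Finset.sum_fn] using h_sum

lemma tendstoInDistribution_inv_sqrt_mul_sum_poissonMeasure (r : ℝ≥0) :
    TendstoInDistribution
      (fun (n : ℕ) (x : ℕ → ℕ) => (√n)⁻¹ * (∑ k ∈ Finset.range n, (x k : ℝ) - n * r))
      atTop id (fun _ => Measure.infinitePi fun _ => poissonMeasure r) (gaussianReal 0 r) := by
  have h_eval (k : ℕ) := measurePreserving_eval_infinitePi (fun _ : ℕ => poissonMeasure r) k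
  have h_mean : ∫ x : ℕ → ℕ, (x 0 : ℝ) ∂(Measure.infinitePi fun _ => poissonMeasure r) = r := by
    rw [← integral_natCast_poissonMeasure r]
    exact (h_eval 0).hasLaw.integral_comp (f := Nat.cast) .of_discrete
  have h_var : variance (fun x : ℕ → ℕ => (x 0 : ℝ))
      (Measure.infinitePi fun _ => poissonMeasure r) = r := by
    rw [← variance_natCast_poissonMeasure r]
    exact (h_eval 0).variance_fun_comp .of_discrete
  have h_clt := tendstoInDistribution_inv_sqrt_mul_sum_sub (X := fun k (x : ℕ → ℕ) => (x k : ℝ))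
    (P := Measure.infinitePi fun _ => poissonMeasure r) (Y := id) (P' := gaussianReal 0 r)
    (by simpa [h_var] using HasLaw.id)
    ((memLp_natCast_poissonMeasure r).comp_measurePreserving (h_eval 0))
    (iIndepFun_infinitePi (X := fun _ (k : ℕ) => (k : ℝ)) fun _ => .of_discrete)
    fun k => ((h_eval k).hasLaw.identDistrib (h_eval 0).hasLaw).comp .of_discrete
  simpa only [h_mean] using h_clt

lemma map_chiSqOne (r : ℝ≥0) :
    chiSqOne.map (fun z => (r : ℝ) * (z - 1)) =
      (gaussianReal 0 r).map fun y => y ^ 2 - (r : ℝ) := by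
  have h_scale : gaussianReal 0 r = (gaussianReal 0 1).map (√r * ·) := by
    rw [gaussianReal_map_const_mul, mul_zero, mul_one]
    congr
    ext
    simp
  rw [chiSqOne, h_scale, Measure.map_map (by fun_prop) (by fun_prop),
    Measure.map_map (by fun_prop) (by fun_prop)]
  congr! 1
  ext z
  simp only [Function.comp_apply, mul_pow, Real.sq_sqrt r.coe_nonneg]
  ring

lemma cellStat_div_eq (r : ℝ) {n : ℕ} (hn : n ≠ 0) (k : ℕ) :
    cellStat (n * r) k / n =
      ((√n)⁻¹ * (k - n * r)) ^ 2 - r - (√n)⁻¹ * ((√n)⁻¹ * (k - n * r)) := by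
  have hn' : (n : ℝ) ≠ 0 := Nat.cast_ne_zero.2 hn
  have h_sq : (√(n : ℝ))⁻¹ ^ 2 = (n : ℝ)⁻¹ := by rw [inv_pow, Real.sq_sqrt n.cast_nonneg]
  rw [mul_pow, ← mul_assoc, ← pow_two, h_sq, cellStat]
  field_simp
  ring

lemma tendstoInDistribution_cellStat_div {Ω' : Type*} {_ : MeasurableSpace Ω'} {P' : Measure Ω'}
    [IsProbabilityMeasure P'] {Ω : ℕ → Type*} {_ : ∀ n, MeasurableSpace (Ω n)}
    {P : ∀ n, Measure (Ω n)} [∀ n, IsProbabilityMeasure (P n)] {r : ℝ≥0}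
    {N : ∀ n, Ω n → ℕ} (hN : ∀ n, HasLaw (N n) (poissonMeasure (n * r)) (P n))
    {Z : Ω' → ℝ} (hZ : HasLaw Z chiSqOne P') :
    TendstoInDistribution (fun (n : ℕ) ω => cellStat (n * r) (N n ω) / n) atTop
      (fun ω => r * (Z ω - 1)) P P' := by
  have h_inv_sqrt : Tendsto (fun n : ℕ => (√n)⁻¹) atTop (𝓝 0) :=
    tendsto_inv_atTop_zero.comp (Real.tendsto_sqrt_atTop.comp tendsto_natCast_atTop_atTop)
  have h_slutsky := (tendstoInDistribution_inv_sqrt_mul_sum_poissonMeasure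
    r).continuous_comp_prodMk_of_tendstoInMeasure_const
      (g := fun y : ℝ × ℝ => y.1 ^ 2 - r - y.2 * y.1) (by fun_prop)
      (tendstoInMeasure_of_tendsto_ae (fun _ => aestronglyMeasurable_const)
        (.of_forall fun _ => h_inv_sqrt)) (fun _ => aemeasurable_const)
  refine tendstoInDistribution_of_map_eventuallyEq h_slutsky
    (fun n => (Measurable.of_discrete (f := fun k => cellStat (n * r) k / n)).comp_aemeasurable
      (hN n).aemeasurable) ((hZ.aemeasurable.sub_const 1).const_mul _) ?_ ?_
  · filter_upwards [eventually_ne_atTop 0] with n hn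
    have h_iid := ((hasLaw_sum_range_infinitePi_poissonMeasure r n).identDistrib (hN n)).comp
      (Measurable.of_discrete (f := fun k => cellStat (n * r) k / n))
    simpa [Function.comp_def, cellStat_div_eq _ hn] using h_iid.map_eq
  · simpa [Function.comp_def, map_chiSqOne] using
      (hZ.identDistrib HasLaw.id).comp (by fun_prop : Measurable fun z => (r : ℝ) * (z - 1))
        |>.map_eq.symm

lemma tendstoInDistribution_sum_mul_cellStat {d : ℕ} (p : PMF (Fin d)) (c : Fin d → ℝ) :
    TendstoInDistribution
      (fun (n : ℕ) s => ∑ j, c j * (cellStat (n * (p j).toReal) (count j s) / n)) atTop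
      (fun z : Fin d → ℝ => ∑ j, c j * ((p j).toReal * (z j - 1)))
      (fun n => sampleLaw n p) (Measure.pi fun _ : Fin d => chiSqOne) := by
  refine tendstoInDistribution_sum_of_iIndepFun (fun j => ?_) (fun n => ?_)
    (iIndepFun_pi (X := fun j (z : ℝ) => c j * ((p j).toReal * (z - 1))) fun j => by fun_prop)
  · have h_cell := tendstoInDistribution_cellStat_div (r := (p j).toNNReal)
      (fun n => hasLaw_count n p j) (measurePreserving_eval (fun _ : Fin d => chiSqOne) j).hasLaw
    exact h_cell.continuous_comp (continuous_const_mul (c j))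
  · exact (iIndepFun_count n p).comp
      (fun j k => c j * (cellStat (n * (p j).toReal) k / n)) fun j => .of_discrete

lemma weightedStat_div_eq_sum {d : ℕ} (n : ℕ) (p : PMF (Fin d)) (w : Fin d → ℝ)
    (s : ℕ × (ℕ → Fin d)) :
    weightedStat n p w s / n =
      ∑ j, (w j)⁻¹ * (cellStat (n * (p j).toReal) (count j s) / n) := by
  rw [weightedStat, Finset.sum_div]
  exact Finset.sum_congr rfl fun j _ => by rw [cellStat]; ring

theorem tendstoInDistribution_weightedStat_div {d : ℕ} (p : PMF (Fin d)) (w : Fin d → ℝ) :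
    TendstoInDistribution (fun (n : ℕ) s => weightedStat n p w s / n) atTop
      (fun z : Fin d → ℝ => ∑ j, (p j).toReal / w j * (z j - 1))
      (fun n => sampleLaw n p) (Measure.pi fun _ : Fin d => chiSqOne) := by
  have h_limit (z : Fin d → ℝ) : ∑ j, (p j).toReal / w j * (z j - 1) =
      ∑ j, (w j)⁻¹ * ((p j).toReal * (z j - 1)) :=
    Finset.sum_congr rfl fun j _ => by ring
  simp_rw [weightedStat_div_eq_sum, h_limit]
  exact tendstoInDistribution_sum_mul_cellStat p fun j => (w j)⁻¹

/-- The power sum `∑ a, p(a) ^ m` of a probability vector. The second and fourth power sums of the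
null determine the scale and the asymptotic normality of the `ℓ₂` statistic. -/
noncomputable def powerSum {α : Type*} [Fintype α] (p : PMF α) (m : ℕ) : ℝ :=
  ∑ a, (p a).toReal ^ m

lemma powerSum_nonneg {α : Type*} [Fintype α] (p : PMF α) (m : ℕ) : 0 ≤ powerSum p m :=
  Finset.sum_nonneg fun _ _ => by positivity

lemma powerSum_two_pos {α : Type*} [Fintype α] (p : PMF α) : 0 < powerSum p 2 := by
  obtain ⟨a, ha⟩ := p.support_nonempty
  refine Finset.sum_pos' (fun _ _ => sq_nonneg _) ⟨a, Finset.mem_univ a, ?_⟩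
  exact pow_pos (ENNReal.toReal_pos ((p.mem_support_iff a).1 ha) (p.apply_ne_top a)) 2

lemma powerSum_uniformOfFintype {α : Type*} [Fintype α] [Nonempty α] (m : ℕ) :
    powerSum (PMF.uniformOfFintype α) m = Fintype.card α / (Fintype.card α : ℝ) ^ m := by
  simp [powerSum, div_eq_mul_inv]

lemma mul_sqrt_powerSum_two_uniformOfFintype {α : Type*} [Fintype α] [Nonempty α] (x : ℝ) :
    x * √(powerSum (PMF.uniformOfFintype α) 2) = x / √(Fintype.card α) := by
  rw [powerSum_uniformOfFintype, pow_two, div_self_mul_self', Real.sqrt_inv, div_eq_mul_inv]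

lemma tendsto_powerSum_ratio_uniformOfFintype {ι : Type*} {l : Filter ι} {d : ι → ℕ}
    [∀ i, NeZero (d i)] (hd : Tendsto d l atTop) :
    Tendsto (fun i => powerSum (PMF.uniformOfFintype (Fin (d i))) 4 /
      powerSum (PMF.uniformOfFintype (Fin (d i))) 2 ^ 2) l (𝓝 0) := by
  have h_inv := tendsto_inv_atTop_zero.comp ((tendsto_natCast_atTop_atTop (R := ℝ)).comp hd)
  refine h_inv.congr fun i => ?_
  have h_card : (d i : ℝ) ≠ 0 := NeZero.ne _
  simp only [powerSum_uniformOfFintype, Fintype.card_fin, Function.comp_apply]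
  field_simp

lemma sum_cellRate_pow {d : ℕ} (n : ℕ) (p : PMF (Fin d)) (m : ℕ) :
    ∑ j, (cellRate n p j : ℝ) ^ m = n ^ m * powerSum p m := by
  simp only [coe_cellRate, mul_pow, powerSum, Finset.mul_sum]

section EllTwo

variable {d : ℕ} (n : ℕ) (p : PMF (Fin d))

lemma ellTwoStat_eq_sum_cellStat :
    ellTwoStat n p = ∑ j, fun s => cellStat (cellRate n p j) (count j s) := by
  ext s
  simp [ellTwoStat, cellStat]

lemma memLp_four_cellStat_count (j : Fin d) :
    MemLp (fun s => cellStat (cellRate n p j) (count j s)) 4 (sampleLaw n p) :=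
  (memLp_four_cellStat _).comp_measurePreserving
    ((hasLaw_count n p j).measurePreserving (measurable_count j))

lemma memLp_two_cellStat_count (j : Fin d) :
    MemLp (fun s => cellStat (cellRate n p j) (count j s)) 2 (sampleLaw n p) :=
  (memLp_four_cellStat_count n p j).mono_exponent (by norm_num)

lemma integral_comp_cellStat_count (f : ℝ → ℝ) (j : Fin d) :
    ∫ s, f (cellStat (cellRate n p j) (count j s)) ∂(sampleLaw n p) =
      ∫ k, f (cellStat (cellRate n p j) k) ∂(poissonMeasure (cellRate n p j)) :=
  (hasLaw_count n p j).integral_comp (f := fun k => f (cellStat (cellRate n p j) k)) .of_discrete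

lemma integral_cellStat_count (j : Fin d) :
    ∫ s, cellStat (cellRate n p j) (count j s) ∂(sampleLaw n p) = 0 :=
  (integral_comp_cellStat_count n p id j).trans (integral_cellStat _)

lemma memLp_ellTwoStat : MemLp (ellTwoStat n p) 2 (sampleLaw n p) := by
  rw [ellTwoStat_eq_sum_cellStat]
  exact memLp_finsetSum' _ fun j _ => memLp_two_cellStat_count n p j

lemma variance_cellStat_count (j : Fin d) :
    variance (fun s => cellStat (cellRate n p j) (count j s)) (sampleLaw n p) =
      2 * (cellRate n p j : ℝ) ^ 2 := by
  rw [variance_of_integral_eq_zero (memLp_two_cellStat_count n p j).aemeasurable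
    (integral_cellStat_count n p j), integral_comp_cellStat_count n p (· ^ 2), integral_cellStat_sq]

lemma iIndepFun_cellStat_count :
    iIndepFun (fun j s => cellStat (cellRate n p j) (count j s)) (sampleLaw n p) :=
  (iIndepFun_count n p).comp (fun j => cellStat (cellRate n p j)) fun _ => .of_discrete

lemma variance_ellTwoStat :
    variance (ellTwoStat n p) (sampleLaw n p) = 2 * (n ^ 2 * powerSum p 2) := by
  rw [ellTwoStat_eq_sum_cellStat, IndepFun.variance_sum
    (fun j _ => memLp_two_cellStat_count n p j) fun i _ j _ hij =>
      (iIndepFun_cellStat_count n p).indepFun hij]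
  simp only [variance_cellStat_count, ← Finset.mul_sum, sum_cellRate_pow]

lemma variance_ellTwoStat_pos {n : ℕ} (hn : n ≠ 0) (p : PMF (Fin d)) :
    0 < variance (ellTwoStat n p) (sampleLaw n p) := by
  have h_pos := powerSum_two_pos p
  rw [variance_ellTwoStat]
  positivity

lemma sqrt_variance_ellTwoStat :
    √(variance (ellTwoStat n p) (sampleLaw n p)) = √2 * (n * √(powerSum p 2)) := by
  rw [variance_ellTwoStat, Real.sqrt_mul zero_le_two, Real.sqrt_mul (by positivity),
    Real.sqrt_sq n.cast_nonneg]

lemma integral_abs_ellTwoStat_le :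
    ∫ s, |ellTwoStat n p s| ∂(sampleLaw n p) ≤ 4 * (n ^ 2 * powerSum p 2) := by
  have h_int (j : Fin d) :
      Integrable (fun s => |cellStat (cellRate n p j) (count j s)|) (sampleLaw n p) :=
    ((memLp_two_cellStat_count n p j).integrable one_le_two).abs
  calc ∫ s, |ellTwoStat n p s| ∂(sampleLaw n p)
      ≤ ∫ s, ∑ j, |cellStat (cellRate n p j) (count j s)| ∂(sampleLaw n p) :=
        integral_mono ((memLp_ellTwoStat n p).integrable one_le_two).abs
          (integrable_finsetSum _ fun j _ => h_int j) fun s => Finset.abs_sum_le_sum_abs _ _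
    _ = ∑ j, ∫ k, |cellStat (cellRate n p j) k| ∂(poissonMeasure (cellRate n p j)) := by
        rw [integral_finsetSum _ fun j _ => h_int j]
        exact Finset.sum_congr rfl fun j _ => integral_comp_cellStat_count n p abs j
    _ ≤ ∑ j, 4 * (cellRate n p j : ℝ) ^ 2 :=
        Finset.sum_le_sum fun j _ => integral_abs_cellStat_le _
    _ = 4 * (n ^ 2 * powerSum p 2) := by rw [← Finset.mul_sum, sum_cellRate_pow]

lemma integral_abs_standardizedEllTwo_le :
    ∫ s, |standardizedEllTwo n p s| ∂(sampleLaw n p) ≤ 2 * √2 * (n * √(powerSum p 2)) := by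
  have h_sq : 4 * (n ^ 2 * powerSum p 2) =
      2 * √2 * (n * √(powerSum p 2)) * (√2 * (n * √(powerSum p 2))) := by
    linear_combination (-2 * n ^ 2 * √(powerSum p 2) ^ 2) * Real.sq_sqrt (zero_le_two (α := ℝ)) -
      4 * (n : ℝ) ^ 2 * Real.sq_sqrt (powerSum_nonneg p 2)
  simp only [standardizedEllTwo, sqrt_variance_ellTwoStat, abs_div, integral_div]
  rw [abs_of_nonneg (by positivity)]
  exact div_le_of_le_mul₀ (by positivity) (by positivity)
    ((integral_abs_ellTwoStat_le n p).trans_eq h_sq)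

lemma sum_integral_cellStat_sq :
    ∑ j, ∫ s, cellStat (cellRate n p j) (count j s) ^ 2 ∂(sampleLaw n p) =
      2 * (n ^ 2 * powerSum p 2) := by
  simp_rw [integral_comp_cellStat_count n p (· ^ 2), integral_cellStat_sq]
  rw [← Finset.mul_sum, sum_cellRate_pow]

lemma sum_integral_cellStat_pow_four_le :
    ∑ j, ∫ s, cellStat (cellRate n p j) (count j s) ^ 4 ∂(sampleLaw n p) ≤
      132 * (n ^ 4 * powerSum p 4 + n ^ 2 * powerSum p 2) := by
  simp_rw [integral_comp_cellStat_count n p (· ^ 4)]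
  rw [← sum_cellRate_pow, ← sum_cellRate_pow, ← Finset.sum_add_distrib, Finset.mul_sum]
  exact Finset.sum_le_sum fun j _ => integral_cellStat_pow_four_le _

lemma sum_integral_cellStat_div_sq {n : ℕ} (hn : n ≠ 0) (p : PMF (Fin d)) :
    ∑ j, ∫ s, (cellStat (cellRate n p j) (count j s) /
      √(variance (ellTwoStat n p) (sampleLaw n p))) ^ 2 ∂(sampleLaw n p) = 1 := by
  have h_pos := variance_ellTwoStat_pos hn p
  simp only [div_pow, integral_div, ← Finset.sum_div]
  rw [sum_integral_cellStat_sq, Real.sq_sqrt h_pos.le, ← variance_ellTwoStat, div_self h_pos.ne']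

lemma sum_integral_cellStat_div_pow_four_le {n : ℕ} (hn : n ≠ 0) (p : PMF (Fin d)) :
    ∑ j, ∫ s, (cellStat (cellRate n p j) (count j s) /
        √(variance (ellTwoStat n p) (sampleLaw n p))) ^ 4 ∂(sampleLaw n p) ≤
      33 * (powerSum p 4 / powerSum p 2 ^ 2 + ((n * √(powerSum p 2)) ^ 2)⁻¹) := by
  have h_pos := powerSum_two_pos p
  have h_sd : √(variance (ellTwoStat n p) (sampleLaw n p)) ^ 4 =
      4 * (n ^ 4 * powerSum p 2 ^ 2) := by
    rw [show 4 = 2 * 2 from rfl, pow_mul, variance_ellTwoStat, Real.sq_sqrt (by positivity)]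
    ring
  simp only [div_pow, integral_div, ← Finset.sum_div]
  rw [h_sd]
  calc _ ≤ 132 * (n ^ 4 * powerSum p 4 + n ^ 2 * powerSum p 2) /
          (4 * (n ^ 4 * powerSum p 2 ^ 2)) := by
        gcongr
        exact sum_integral_cellStat_pow_four_le n p
    _ = 33 * (powerSum p 4 / powerSum p 2 ^ 2 + ((n * √(powerSum p 2)) ^ 2)⁻¹) := by
        rw [mul_pow, Real.sq_sqrt h_pos.le]
        field_simp
        ring

end EllTwo

section HighDimensional

variable {d n : ℕ → ℕ} {p : ∀ k, PMF (Fin (d k))}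

theorem tendstoInDistribution_standardizedEllTwo_gaussianReal
    (h_flat : Tendsto (fun k => powerSum (p k) 4 / powerSum (p k) 2 ^ 2) atTop (𝓝 0))
    (h_large : Tendsto (fun k => n k * √(powerSum (p k) 2)) atTop atTop) :
    TendstoInDistribution (fun k => standardizedEllTwo (n k) (p k)) atTop (id : ℝ → ℝ)
      (fun k => sampleLaw (n k) (p k)) (gaussianReal 0 1) := by
  let sd := fun k => √(variance (ellTwoStat (n k) (p k)) (sampleLaw (n k) (p k)))
  have h_eq (k : ℕ) : standardizedEllTwo (n k) (p k) =
      fun s => ∑ j, cellStat (cellRate (n k) (p k) j) (count j s) / sd k := by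
    ext s
    simp only [standardizedEllTwo, ellTwoStat_eq_sum_cellStat (n k) (p k), Finset.sum_apply,
      Finset.sum_div, sd]
  have hn : ∀ᶠ k in atTop, n k ≠ 0 := by
    filter_upwards [h_large.eventually_ne_atTop 0] with k hk
    exact Nat.cast_ne_zero.1 (left_ne_zero_of_mul hk)
  have h_bound : Tendsto (fun k => 33 * (powerSum (p k) 4 / powerSum (p k) 2 ^ 2 +
      ((n k * √(powerSum (p k) 2)) ^ 2)⁻¹)) atTop (𝓝 0) := by
    have h_inv := tendsto_inv_atTop_zero.comp ((tendsto_pow_atTop two_ne_zero).comp h_large)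
    simpa using (h_flat.add h_inv).const_mul 33
  simp_rw [h_eq]
  refine tendstoInDistribution_sum_of_tendsto_sum_integral_pow_four (v := 1)
    (fun k j => ?_) (fun k => ?_) (fun k j => ?_) ?_ ?_ HasLaw.id
  · simpa only [div_eq_mul_inv] using
      (memLp_four_cellStat_count (n k) (p k) j).mul_const (sd k)⁻¹
  · exact (iIndepFun_cellStat_count (n k) (p k)).comp (fun _ x => x / sd k) fun _ => by fun_prop
  · rw [integral_div, integral_cellStat_count, zero_div]
  · exact tendsto_const_nhds.congr' <| by
      filter_upwards [hn] with k hk using (sum_integral_cellStat_div_sq hk (p k)).symm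
  · refine squeeze_zero' (.of_forall fun k => ?_) ?_ h_bound
    · exact Finset.sum_nonneg fun j _ =>
        integral_nonneg fun s => Even.pow_nonneg (by decide) _
    · filter_upwards [hn] with k hk using sum_integral_cellStat_div_pow_four_le hk (p k)

theorem tendstoInDistribution_standardizedEllTwo_dirac
    (h_small : Tendsto (fun k => n k * √(powerSum (p k) 2)) atTop (𝓝 0)) :
    TendstoInDistribution (fun k => standardizedEllTwo (n k) (p k)) atTop (id : ℝ → ℝ)
      (fun k => sampleLaw (n k) (p k)) (Measure.dirac 0) := by
  refine tendstoInDistribution_dirac_of_tendsto_integral_norm_sub (fun k =>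
    ((memLp_ellTwoStat (n k) (p k)).integrable one_le_two).div_const _) ?_
  refine squeeze_zero (fun k => integral_nonneg fun s => norm_nonneg _) (fun k => ?_)
    (by simpa using h_small.const_mul (2 * √2))
  simpa only [sub_zero, Real.norm_eq_abs] using integral_abs_standardizedEllTwo_le (n k) (p k)

end HighDimensional

end PoissonizedMultinomial

theorem mainTheorem9_general :
    (∀ (d : ℕ) (p₀ : PMF (Fin d)) (w : Fin d → ℝ), (∀ j, w j ≠ 0) →
      TendstoInDistribution
        (fun (n : ℕ) s => PoissonizedMultinomial.weightedStat n p₀ w s / n) atTop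
        (fun z : Fin d → ℝ => ∑ j, (p₀ j).toReal / w j * (z j - 1))
        (fun n => PoissonizedMultinomial.sampleLaw n p₀)
        (Measure.pi fun _ : Fin d => PoissonizedMultinomial.chiSqOne)) ∧
    (∀ (d n : ℕ → ℕ) (p₀ : ∀ k, PMF (Fin (d k))), (∀ k, 0 < n k) →
      (∀ k,
        MemLp (PoissonizedMultinomial.ellTwoStat (n k) (p₀ k)) 2
          (PoissonizedMultinomial.sampleLaw (n k) (p₀ k)) ∧
        0 < variance (PoissonizedMultinomial.ellTwoStat (n k) (p₀ k))
          (PoissonizedMultinomial.sampleLaw (n k) (p₀ k))) ∧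
      (Tendsto (fun k => PoissonizedMultinomial.powerSum (p₀ k) 4 /
          PoissonizedMultinomial.powerSum (p₀ k) 2 ^ 2) atTop (𝓝 0) →
        Tendsto (fun k => n k * √(PoissonizedMultinomial.powerSum (p₀ k) 2)) atTop atTop →
        TendstoInDistribution
          (fun k => PoissonizedMultinomial.standardizedEllTwo (n k) (p₀ k)) atTop
          (id : ℝ → ℝ)
          (fun k => PoissonizedMultinomial.sampleLaw (n k) (p₀ k))
          (gaussianReal 0 1)) ∧
      (Tendsto (fun k => n k * √(PoissonizedMultinomial.powerSum (p₀ k) 2)) atTop (𝓝 0) →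
        TendstoInDistribution
          (fun k => PoissonizedMultinomial.standardizedEllTwo (n k) (p₀ k)) atTop
          (id : ℝ → ℝ)
          (fun k => PoissonizedMultinomial.sampleLaw (n k) (p₀ k))
          (Measure.dirac 0))) :=
  ⟨fun _ p₀ w _ => PoissonizedMultinomial.tendstoInDistribution_weightedStat_div p₀ w,
    fun _ n p₀ hn =>
      ⟨fun k => ⟨PoissonizedMultinomial.memLp_ellTwoStat (n k) (p₀ k),
        PoissonizedMultinomial.variance_ellTwoStat_pos (hn k).ne' (p₀ k)⟩,
      PoissonizedMultinomial.tendstoInDistribution_standardizedEllTwo_gaussianReal,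
      PoissonizedMultinomial.tendstoInDistribution_standardizedEllTwo_dirac⟩⟩

theorem mainTheorem9 :
    -- Classical asymptotics: the null `p₀` and the positive weights `w` are fixed, `n → ∞`;
    -- the limit is a weighted sum of independent centred `χ²₁` variables `Z₁, …, Z_d`.
    (∀ (d : ℕ) (p₀ : PMF (Fin d)) (w : Fin d → ℝ), (∀ j, 0 < w j) →
      TendstoInDistribution
        (fun (n : ℕ) s => PoissonizedMultinomial.weightedStat n p₀ w s / n) atTop
        (fun z : Fin d → ℝ => ∑ j, (p₀ j).toReal / w j * (z j - 1))
        (fun n => PoissonizedMultinomial.sampleLaw n p₀)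
        (Measure.pi fun _ : Fin d => PoissonizedMultinomial.chiSqOne)) ∧
    -- High-dimensional asymptotics: the null is uniform on `d` cells, `d → ∞`.
    (∀ (d n : ℕ → ℕ) [∀ k, NeZero (d k)], (∀ k, 0 < n k) → Tendsto d atTop atTop →
      -- the statistic has a finite and positive variance under the null,
      (∀ k,
        MemLp (PoissonizedMultinomial.ellTwoStat (n k) (PMF.uniformOfFintype (Fin (d k)))) 2
          (PoissonizedMultinomial.sampleLaw (n k) (PMF.uniformOfFintype (Fin (d k)))) ∧
        0 < variance
          (PoissonizedMultinomial.ellTwoStat (n k) (PMF.uniformOfFintype (Fin (d k))))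
          (PoissonizedMultinomial.sampleLaw (n k) (PMF.uniformOfFintype (Fin (d k))))) ∧
      -- the limit is `N(0, 1)` if `n / √d → ∞`,
      (Tendsto (fun k => (n k : ℝ) / √(d k : ℝ)) atTop atTop →
        TendstoInDistribution
          (fun k => PoissonizedMultinomial.standardizedEllTwo (n k)
            (PMF.uniformOfFintype (Fin (d k)))) atTop
          (id : ℝ → ℝ)
          (fun k => PoissonizedMultinomial.sampleLaw (n k) (PMF.uniformOfFintype (Fin (d k))))
          (gaussianReal 0 1)) ∧
      -- and the limit is `δ₀` if `n / √d → 0`.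
      (Tendsto (fun k => (n k : ℝ) / √(d k : ℝ)) atTop (𝓝 0) →
        TendstoInDistribution
          (fun k => PoissonizedMultinomial.standardizedEllTwo (n k)
            (PMF.uniformOfFintype (Fin (d k)))) atTop
          (id : ℝ → ℝ)
          (fun k => PoissonizedMultinomial.sampleLaw (n k) (PMF.uniformOfFintype (Fin (d k))))
          (Measure.dirac 0))) := by
  refine ⟨fun d p₀ w hw => mainTheorem9_general.1 d p₀ w fun j => (hw j).ne',
    fun d n _ hn hd => ?_⟩
  obtain ⟨h_var, h_gaussian, h_dirac⟩ :=
    mainTheorem9_general.2 d n (fun k => PMF.uniformOfFintype (Fin (d k))) hn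
  simp_rw [PoissonizedMultinomial.mul_sqrt_powerSum_two_uniformOfFintype,
    Fintype.card_fin] at h_gaussian h_dirac
  exact ⟨h_var, h_gaussian
    (PoissonizedMultinomial.tendsto_powerSum_ratio_uniformOfFintype hd), h_dirac⟩
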